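/- Let $\mathcal T_c$ be the class of all complete first-order theories $T$ in a countable language whose set $S(T)$ of complete types over $\varnothing$ (in finitely many variables) has cardinality $2^{\omega}$. A model $M$ of $T$ is prime over a tuple $\bar a\in M$ if for every model $N$ of $T$ and every $\bar b\in N$ with the same complete type as $\bar a$ there is an elementary embedding $M\to N$ mapping $\bar a$ to $\bar b$. A model of $T$ is limit if it is not prime over any finite tuple of its elements but is the union of an elementary chain $(M_n)_{n\in\omega}$ of models of $T$ each of which is prime over some finite tuple of its elements. Let $P(T)$, $L(T)$ and $\mathrm{NPL}(T)$ be the numbers of isomorphism types of countable models of $T$ that are, respectively, prime over some finite tuple, limit, and neither of the two, and put $\mathrm{cm}_3(T)=(P(T),L(T),\mathrm{NPL}(T))$. Proposition 5.4. There is no theory $T\in\mathcal T_c$ such that $\mathrm{cm}_3(T)$ has any of the following forms: (1) $(\lambda_1,2^{\omega},\lambda_3)$, where $\lambda_1,\lambda_3<2^{\omega}$; (2) $(2^{\omega},\lambda_2,\lambda_3)$, where $\lambda_2,\lambda_3<2^{\omega}$. -/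

import Mathlib

open FirstOrder Cardinal

universe u v w

namespace CountableModels

/-- `T` is a complete theory in a countable language with continuum many complete types: `S(T)` is
the set of all complete types over the empty set in finitely many variables. -/
structure IsUnsmall {L : FirstOrder.Language.{u, v}} (T : L.Theory) : Prop where
  countable_language : Countable L.Symbols
  complete : T.IsComplete
  continuum_types : #(Σ n : ℕ, T.CompleteType (Fin n)) = 𝔠

/-- `M` is prime over the tuple `a`: whenever a tuple `b` of a structure `N` has the same complete
type as `a`, there is an elementary embedding of `M` into `N` that maps `a` to `b`. -/
def IsPrimeOver (L : FirstOrder.Language.{u, v}) {M : Type w} [L.Structure M] {n : ℕ} (a : Fin n → M) :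
    Prop :=
  ∀ (N : Type w) [L.Structure N] (b : Fin n → N),
    (∀ φ : L.Formula (Fin n), φ.Realize a ↔ φ.Realize b) →
      ∃ f : M ↪ₑ[L] N, ∀ i, f (a i) = b i

/-- `M` is a model of `T` that is prime over some finite tuple of its elements. -/
def IsPrimeOverTuple {L : FirstOrder.Language.{u, v}} (T : L.Theory) (M : Type w) [L.Structure M] : Prop :=
  M ⊨ T ∧ ∃ (n : ℕ) (a : Fin n → M), IsPrimeOver L a

/-- `M` is a limit model of `T`: it is not prime over a tuple, and it is the union of an
elementary chain `S 0 ≼ S 1 ≼ ⋯` of models of `T` that are prime over tuples. -/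
def IsLimitModel {L : FirstOrder.Language.{u, v}} (T : L.Theory) (M : Type w) [L.Structure M] : Prop :=
  ¬ IsPrimeOverTuple T M ∧
    ∃ S : ℕ → L.Substructure M,
      (∀ n, ∃ f : S n ↪ₑ[L] S (n + 1), ∀ x : S n, (f x : M) = x) ∧
      (∀ n, IsPrimeOverTuple T (S n)) ∧
      ∀ x : M, ∃ n, x ∈ S n

/-- The countable models of `T`; up to isomorphism their carriers may be taken in `Type`. (If `T`
has infinitely many types then every model of `T` is infinite, so these are the models of
cardinality `ℵ₀`.) -/
def CountableModel {L : FirstOrder.Language.{u, v}} (T : L.Theory) : Type (max u v 1) :=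
  {M : FirstOrder.Language.Theory.ModelType.{u, v, 0} T // Countable M}

/-- Isomorphism of countable models. -/
def isoSetoid {L : FirstOrder.Language.{u, v}} (T : L.Theory) : Setoid (CountableModel T) where
  r M N := Nonempty (M.1 ≃[L] N.1)
  iseqv :=
    { refl := fun M => ⟨FirstOrder.Language.Equiv.refl L M.1⟩
      symm := fun ⟨f⟩ => ⟨f.symm⟩
      trans := fun ⟨f⟩ ⟨g⟩ => ⟨g.comp f⟩ }

/-- The set of isomorphism types of countable models of `T`. -/
def IsoType {L : FirstOrder.Language.{u, v}} (T : L.Theory) : Type (max u v 1) :=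
  Quotient (isoSetoid T)

/-- The isomorphism types of the countable models that are prime over tuples. -/
def primeTypes {L : FirstOrder.Language.{u, v}} (T : L.Theory) : Set (IsoType T) :=
  {c | ∃ M : CountableModel T, Quotient.mk (isoSetoid T) M = c ∧ IsPrimeOverTuple T M.1}

/-- The isomorphism types of the countable models that are limit models. -/
def limitTypes {L : FirstOrder.Language.{u, v}} (T : L.Theory) : Set (IsoType T) :=
  {c | ∃ M : CountableModel T, Quotient.mk (isoSetoid T) M = c ∧ IsLimitModel T M.1}

/-- The isomorphism types of all other countable models. -/
def otherTypes {L : FirstOrder.Language.{u, v}} (T : L.Theory) : Set (IsoType T) :=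
  {c | c ∉ primeTypes T ∧ c ∉ limitTypes T}

/-- The triple of distribution of countable models `(P(T), L(T), NPL(T))`. -/
noncomputable def cm3 {L : FirstOrder.Language.{u, v}} (T : L.Theory) :
    Cardinal.{max u v 1} × Cardinal.{max u v 1} × Cardinal.{max u v 1} :=
  (#(primeTypes T), #(limitTypes T), #(otherTypes T))

end CountableModels

/-!
A countable model realizes only countably many types, so a class of isomorphism types of countable
models in which all `𝔠` types are realized has at least `𝔠` elements. Two classes have this
property. A type realized in a limit model is realized in a member of the elementary chain, hence
in a model prime over a tuple, so limit models may be disregarded. Conversely, every type is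
realized in a countable model that is not prime over a tuple: all countable models prime over a
realization of `p` embed in each other, so some type `q p` is realized in none of them, and a
countable model whose set of realized types is closed under `p ↦ q p` is not prime over any of its
tuples.
-/

namespace CountableModels

open FirstOrder.Language

universe u' v' w'

section Types

variable {L : FirstOrder.Language.{u, v}} {T : L.Theory} {α M N : Type*}
  [L.Structure M] [Nonempty M] [M ⊨ T] [L.Structure N] [Nonempty N] [N ⊨ T]

theorem typeOf_eq_typeOf_iff {x : α → M} {y : α → N} :
    T.typeOf x = T.typeOf y ↔ ∀ φ : L.Formula α, φ.Realize x ↔ φ.Realize y := by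
  simp only [SetLike.ext_iff, Theory.CompleteType.mem_typeOf,
    Formula.equivSentence.symm.forall_congr_left, Equiv.symm_symm, Equiv.symm_apply_apply]

theorem typeOf_comp_elementaryEmbedding (f : M ↪ₑ[L] N) (x : α → M) :
    T.typeOf (f ∘ x) = T.typeOf x :=
  typeOf_eq_typeOf_iff.2 fun φ => f.map_formula φ x

variable (T M) in
/-- The set of complete types of finite tuples of elements of `M`, as a subset of `S(T)`. -/
def tupleTypes : Set (Σ n : ℕ, T.CompleteType (Fin n)) :=
  Set.range fun a : Σ n : ℕ, Fin n → M => ⟨a.1, T.typeOf a.2⟩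

theorem typeOf_mem_tupleTypes {n : ℕ} (a : Fin n → M) : ⟨n, T.typeOf a⟩ ∈ tupleTypes T M :=
  ⟨⟨n, a⟩, rfl⟩

theorem countable_tupleTypes [Countable M] : (tupleTypes T M).Countable :=
  Set.countable_range _

theorem tupleTypes_subset_of_elementaryEmbedding (f : M ↪ₑ[L] N) :
    tupleTypes T M ⊆ tupleTypes T N := by
  rintro _ ⟨⟨n, a⟩, rfl⟩
  exact ⟨⟨n, f ∘ a⟩, by simp only [typeOf_comp_elementaryEmbedding]⟩

theorem tupleTypes_eq_of_equiv (f : M ≃[L] N) : tupleTypes T M = tupleTypes T N :=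
  (tupleTypes_subset_of_elementaryEmbedding f.toElementaryEmbedding).antisymm
    (tupleTypes_subset_of_elementaryEmbedding f.symm.toElementaryEmbedding)

end Types

section Compactness

variable {L : FirstOrder.Language.{u, v}} {T : L.Theory}

theorem exists_modelType_realize_of_finite {α : Type w} {ι : Type*} (φ : ι → L.Formula α)
    (h : ∀ t : Finset ι, ∃ (M : Theory.ModelType.{u, v, w'} T) (x : α → M),
      ∀ i ∈ t, (φ i).Realize x) :
    ∃ (M : Theory.ModelType.{u, v, max u v w} T) (x : α → M), ∀ i, (φ i).Realize x := by
  let S (t : Finset ι) : L[[α]].Theory := (fun i => Formula.equivSentence (φ i)) '' t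
  have hS : Monotone S := fun s t hst => Set.image_mono hst
  have hsat : ((L.lhomWithConstants α).onTheory T ∪ ⋃ t, S t).IsSatisfiable := by
    rw [Set.union_iUnion,
      Theory.isSatisfiable_directed_union_iff (monotone_const.union hS).directed_le]
    intro t
    obtain ⟨M, x, hx⟩ := h t
    refine (T.typeOf x).isMaximal.1.mono (Set.union_subset (T.typeOf x).subset ?_)
    rintro _ ⟨i, hi, rfl⟩
    exact Theory.CompleteType.formula_mem_typeOf.2 (hx i hi)
  obtain ⟨p, hp⟩ : {p : T.CompleteType α | ⋃ t, S t ⊆ (p : L[[α]].Theory)}.Nonempty := by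
    rwa [Set.nonempty_iff_ne_empty, Ne, Theory.CompleteType.setOfPred_subset_eq_empty_iff, not_not]
  obtain ⟨M, x, rfl⟩ := T.exists_modelType_is_realized_in p
  refine ⟨M, x, fun i => Theory.CompleteType.formula_mem_typeOf.1 (hp ?_)⟩
  exact Set.mem_iUnion.2 ⟨{i}, i, Finset.mem_singleton_self i, rfl⟩

theorem exists_realize_iff_realize_exClosure {M α : Type*} [L.Structure M] [Nonempty M]
    [DecidableEq α] (φ : L.Formula α) : (∃ x : α → M, φ.Realize x) ↔ M ⊨ φ.exClosure := by
  rw [← Formula.exists_realize_equivSentence_iff_realize_exClosure]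
  exact exists_congr fun x =>
    letI := constantsOn.structure x
    (Formula.realize_equivSentence M φ).symm

theorem exists_realize_of_elementarilyEquivalent {M N α ι : Type*} [L.Structure M] [Nonempty M]
    [L.Structure N] [Nonempty N] (h : M ≅[L] N) [Finite ι] (φ : ι → L.Formula α) {x : α → M}
    (hx : ∀ i, (φ i).Realize x) : ∃ y : α → N, ∀ i, (φ i).Realize y := by
  classical
  simp only [← Formula.realize_iInf] at hx ⊢
  rw [exists_realize_iff_realize_exClosure, ← h.realize_sentence,
    ← exists_realize_iff_realize_exClosure]
  exact ⟨x, hx⟩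

theorem typeOf_eq_of_forall_realize {M α : Type*} [L.Structure M] [Nonempty M] [M ⊨ T]
    {p : T.CompleteType α} {x : α → M}
    (h : ∀ φ : L.Formula α, Formula.equivSentence φ ∈ p → φ.Realize x) : T.typeOf x = p := by
  refine SetLike.ext fun ψ => ?_
  obtain ⟨φ, rfl⟩ := Formula.equivSentence.surjective ψ
  rw [Theory.CompleteType.formula_mem_typeOf]
  refine ⟨fun hφ => ?_, h φ⟩
  by_contra hp
  rw [← Theory.CompleteType.not_mem_iff, ← Formula.equivSentence_not] at hp
  exact Formula.realize_not.1 (h _ hp) hφ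

theorem exists_modelType_forall_typeOf_eq (hT : T.IsComplete) {ι : Type w} {α : ι → Type w'}
    (p : ∀ i, T.CompleteType (α i)) :
    ∃ M : Theory.ModelType.{u, v, max u v w w'} T, ∀ i, ∃ x : α i → M, T.typeOf x = p i := by
  let φ (j : Σ i, {φ : L.Formula (α i) // Formula.equivSentence φ ∈ p i}) : L.Formula (Σ i, α i) :=
    j.2.1.relabel (Sigma.mk j.1)
  obtain ⟨M, x, hx⟩ : ∃ (M : Theory.ModelType.{u, v, max u v w w'} T) (x : (Σ i, α i) → M),
      ∀ j, (φ j).Realize x := by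
    refine exists_modelType_realize_of_finite φ fun t => ?_
    obtain ⟨M₀⟩ := hT.1
    have exists_tuple (i) : ∃ y : α i → M₀, ∀ ψ, ⟨i, ψ⟩ ∈ t → ψ.1.Realize y := by
      obtain ⟨M, z, hz⟩ := T.exists_modelType_is_realized_in (p i)
      let s := t.preimage (Sigma.mk i) sigma_mk_injective.injOn
      have hzs (ψ : s) : ψ.1.1.Realize z := by
        rw [← Theory.CompleteType.formula_mem_typeOf (T := T), hz]
        exact ψ.1.2
      obtain ⟨y, hy⟩ :=
        exists_realize_of_elementarilyEquivalent (hT.models_elementarily_equivalent M M₀) _ hzs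
      exact ⟨y, fun ψ hψ => hy ⟨ψ, Finset.mem_preimage.2 hψ⟩⟩
    choose y hy using exists_tuple
    exact ⟨M₀, fun a => y a.1 a.2, fun j hj => Formula.realize_relabel.2 (hy j.1 j.2 hj)⟩
  refine ⟨M, fun i => ⟨fun a => x ⟨i, a⟩, typeOf_eq_of_forall_realize fun ψ hψ => ?_⟩⟩
  exact Formula.realize_relabel.1 (hx ⟨i, ψ, hψ⟩)

end Compactness

section LowenheimSkolem

/-- A language with an `n`-ary function symbol for every `n` and every element of `ι`, used to close
substructures under operations that are not definable. -/
def operationLanguage (ι : Type) : FirstOrder.Language.{0, 0} :=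
  ⟨fun _ => ι, fun _ => Empty⟩

instance (ι : Type) [Countable ι] : Countable (operationLanguage ι).Symbols :=
  have : ∀ n, Countable ((operationLanguage ι).Functions n) :=
    fun _ => inferInstanceAs (Countable ι)
  have : ∀ n, Countable ((operationLanguage ι).Relations n) :=
    fun _ => inferInstanceAs (Countable Empty)
  inferInstanceAs (Countable (_ ⊕ _))

instance (L : FirstOrder.Language.{u, v}) (L' : FirstOrder.Language.{u', v'}) [Countable L.Symbols]
    [Countable L'.Symbols] : Countable (L.sum L').Symbols := by
  rw [← mk_le_aleph0_iff]
  refine card_sum.trans_le (add_le_aleph0.2 ⟨?_, ?_⟩) <;>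
    exact lift_le_aleph0.2 mk_le_aleph0

/-- An elementary substructure for a language is elementary for any smaller language. -/
def elementarySubstructureReduct {L : FirstOrder.Language.{u, v}}
    {L' : FirstOrder.Language.{u', v'}} (ϕ : L →ᴸ L') {M : Type*}
    [L.Structure M] [L'.Structure M] [ϕ.IsExpansionOn M] (S : L'.ElementarySubstructure M) :
    L.ElementarySubstructure M where
  toSubstructure := ϕ.substructureReduct S.toSubstructure
  isElementary' n φ x := by
    let _ : L.Structure S := (ϕ.substructureReduct S.toSubstructure).inducedStructure
    have : ϕ.IsExpansionOn S :=
      { map_onFunction := fun f x => Subtype.ext (ϕ.map_onFunction (M := M) f fun i => x i)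
        map_onRelation := fun R x => ϕ.map_onRelation (M := M) R fun i => x i }
    have h := S.isElementary (ϕ.onFormula φ) x
    rw [LHom.realize_onFormula] at h
    exact h.trans (LHom.realize_onFormula (M := S) ϕ φ)

theorem exists_countable_elementarySubstructure {L : FirstOrder.Language.{u, v}}
    [Countable L.Symbols] {M : Type*} [L.Structure M] {s : Set M} (hs : s.Countable) :
    ∃ S : L.ElementarySubstructure M, Countable S ∧ s ⊆ S := by
  by_cases hM : Countable M
  · exact ⟨⊤, inferInstance, Set.subset_univ s⟩
  · have : Uncountable M := not_countable_iff.1 hM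
    have hL : L.card ≤ ℵ₀ := mk_le_aleph0
    obtain ⟨S, hsS, hS⟩ := exists_elementarySubstructure_card_eq L s aleph0.{0} le_rfl
      (by simpa only [lift_le_aleph0, lift_aleph0] using hs.le_aleph0)
      (by simpa only [lift_le_aleph0, lift_aleph0] using hL)
      (by simpa only [lift_aleph0, aleph0_le_lift] using aleph0_le_mk M)
    exact ⟨S, mk_le_aleph0_iff.1 (lift_le_aleph0.1 (hS.trans_le lift_aleph0.le)), hsS⟩

theorem exists_countable_elementarySubstructure_closed {L : FirstOrder.Language.{u, v}}
    [Countable L.Symbols] {M : Type*} [L.Structure M] {s : Set M} (hs : s.Countable)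
    (C : (Σ n : ℕ, Fin n → M) → Set M) (hC : ∀ a, (C a).Countable) :
    ∃ S : L.ElementarySubstructure M, Countable S ∧ s ⊆ S ∧
      ∀ a : Σ n : ℕ, Fin n → M, (∀ i, a.2 i ∈ S) → C a ⊆ S := by
  cases isEmpty_or_nonempty M
  · exact ⟨⊤, inferInstance, Set.subset_univ s, fun a _ => Set.subset_univ (C a)⟩
  choose f hf using fun a => Set.countable_iff_exists_subset_range.1 (hC a)
  let _ : (operationLanguage ℕ).Structure M := ⟨fun i x => f ⟨_, x⟩ i, fun r => r.elim⟩
  obtain ⟨S, hScount, hsS⟩ :=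
    exists_countable_elementarySubstructure (L := L.sum (operationLanguage ℕ)) hs
  refine ⟨elementarySubstructureReduct LHom.sumInl S, hScount, hsS, fun a ha => ?_⟩
  refine (hf a).trans ?_
  rintro _ ⟨i, rfl⟩
  let symb : (operationLanguage ℕ).Functions a.1 := i
  exact S.toSubstructure.fun_mem (LHom.sumInr.onFunction symb) a.2 ha

end LowenheimSkolem

section ElementaryChains

variable {L : FirstOrder.Language.{u, v}} {T : L.Theory} {M : Type w} [L.Structure M]

/-- `S` is an elementary substructure of `S'`, for substructures of a common structure. -/
def ElementaryLE (S S' : L.Substructure M) : Prop :=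
  ∃ f : S ↪ₑ[L] S', ∀ x : S, (f x : M) = x

instance : Std.Refl (ElementaryLE (L := L) (M := M)) :=
  ⟨fun S => ⟨ElementaryEmbedding.refl L S, fun _ => rfl⟩⟩

instance : IsTrans (L.Substructure M) ElementaryLE :=
  ⟨fun _ _ _ ⟨f, hf⟩ ⟨g, hg⟩ => ⟨g.comp f, fun x => (hg (f x)).trans (hf x)⟩⟩

theorem ElementaryLE.le {S S' : L.Substructure M} : ElementaryLE S S' → S ≤ S' := by
  rintro ⟨f, hf⟩ x hx
  have hfx := (f ⟨x, hx⟩).2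
  rwa [hf] at hfx

theorem ElementaryLE.realize_iff {S S' : L.Substructure M} (h : ElementaryLE S S') {α : Type*}
    {k : ℕ} (φ : L.BoundedFormula α k) (y : α → S) (x : Fin k → S) :
    φ.Realize (fun i => ⟨y i, h.le (y i).2⟩ : α → S') (fun i => ⟨x i, h.le (x i).2⟩) ↔
      φ.Realize y x := by
  obtain ⟨f, hf⟩ := h
  rw [← f.map_boundedFormula]
  exact iff_of_eq (congrArg₂ _ (funext fun i => Subtype.ext (hf (y i)).symm)
    (funext fun i => Subtype.ext (hf (x i)).symm))

theorem realize_coe_iff_of_directed {ι : Type*} {S : ι → L.Substructure M}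
    (hS : Directed ElementaryLE S) (hM : ∀ x : M, ∃ i, x ∈ S i) {α : Type*} {k : ℕ}
    (φ : L.BoundedFormula α k) (i : ι) (y : α → S i) (x : Fin k → S i) :
    φ.Realize (fun a => (y a : M)) (fun a => (x a : M)) ↔ φ.Realize y x := by
  induction φ generalizing i with
  | falsum => rfl
  | equal t₁ t₂ =>
    exact (BoundedFormula.IsAtomic.equal t₁ t₂).isQF.realize_embedding (S i).subtype
  | rel R ts => exact (BoundedFormula.IsAtomic.rel R ts).isQF.realize_embedding (S i).subtype
  | imp φ ψ ihφ ihψ => rw [BoundedFormula.realize_imp, BoundedFormula.realize_imp, ihφ, ihψ]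
  | all φ ih =>
    have snoc_coe {n : ℕ} (j : ι) (x : Fin n → S j) (z : S j) :
        (Fin.snoc (fun a => (x a : M)) (z : M) : Fin (n + 1) → M) =
          fun a => ((Fin.snoc x z : Fin (n + 1) → S j) a : M) :=
      (Fin.comp_snoc (fun z : S j => (z : M)) x z).symm
    refine ⟨fun h z => ?_, fun h z => ?_⟩
    · rw [← ih, ← snoc_coe]
      exact h z
    · obtain ⟨j, hzj⟩ := hM z
      obtain ⟨m, him, hjm⟩ := hS i j
      have hm := (him.realize_iff _ y x).2 h ⟨z, hjm.le hzj⟩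
      rwa [← ih, ← snoc_coe] at hm

theorem isElementary_of_directed {ι : Type*} {S : ι → L.Substructure M}
    (hS : Directed ElementaryLE S) (hM : ∀ x : M, ∃ i, x ∈ S i) (i : ι) : (S i).IsElementary := by
  intro n φ x
  rw [Formula.Realize, Formula.Realize, ← realize_coe_iff_of_directed hS hM φ i x default]
  exact iff_of_eq (congrArg _ (Subsingleton.elim _ _))

variable [Nonempty M] [M ⊨ T]

theorem typeOf_mem_tupleTypes_of_forall_mem (S : L.ElementarySubstructure M) {n : ℕ}
    {a : Fin n → M} (ha : ∀ i, a i ∈ S) : ⟨n, T.typeOf a⟩ ∈ tupleTypes T S := by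
  refine ⟨⟨n, fun i => ⟨a i, ha i⟩⟩, ?_⟩
  simp only [← typeOf_comp_elementaryEmbedding S.subtype]
  rfl

theorem IsLimitModel.exists_isPrimeOverTuple (hM : IsLimitModel T M)
    {p : Σ n : ℕ, T.CompleteType (Fin n)} (hp : p ∈ tupleTypes T M) :
    ∃ S : L.ElementarySubstructure M, IsPrimeOverTuple T S ∧ p ∈ tupleTypes T S := by
  obtain ⟨-, S, hS, hprime, hunion⟩ := hM
  have hmono {m n : ℕ} (h : m ≤ n) : ElementaryLE (S m) (S n) :=
    Nat.rel_of_forall_rel_succ_of_le ElementaryLE hS h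
  have hdir : Directed ElementaryLE S :=
    fun m n => ⟨max m n, hmono (le_max_left m n), hmono (le_max_right m n)⟩
  obtain ⟨⟨n, a⟩, rfl⟩ := hp
  choose k hk using fun i => hunion (a i)
  obtain ⟨m, hm⟩ := Finite.exists_le k
  exact ⟨⟨S m, isElementary_of_directed hdir hunion m⟩, hprime m,
    typeOf_mem_tupleTypes_of_forall_mem _ fun i => (hmono (hm i)).le (hk i)⟩

end ElementaryChains

section CountableModel

variable {L : FirstOrder.Language.{u, v}} {T : L.Theory}

theorem exists_countableModel_equiv (M : Type w) [L.Structure M] [Nonempty M] [M ⊨ T]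
    [Countable M] : ∃ K : CountableModel T, Nonempty (M ≃[L] K.1) := by
  let _ : L.Structure (Shrink.{0} M) := (equivShrink.{0} M).inducedStructure
  let e : M ≃[L] Shrink.{0} M := (equivShrink.{0} M).inducedStructureEquiv
  have : Nonempty (Shrink.{0} M) := (equivShrink.{0} M).symm.nonempty
  have : Shrink.{0} M ⊨ T := StrongHomClass.theory_model e
  exact ⟨⟨Theory.ModelType.of T (Shrink.{0} M), e.symm.injective.countable⟩, ⟨e⟩⟩

theorem exists_countableModel_mapsTo_tupleTypes [Countable L.Symbols] (hT : T.IsComplete)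
    (q : (Σ n : ℕ, T.CompleteType (Fin n)) → Σ n : ℕ, T.CompleteType (Fin n))
    (p : Σ n : ℕ, T.CompleteType (Fin n)) :
    ∃ K : CountableModel T, p ∈ tupleTypes T K.1 ∧
      Set.MapsTo q (tupleTypes T K.1) (tupleTypes T K.1) := by
  obtain ⟨N, hN⟩ := exists_modelType_forall_typeOf_eq hT
    fun r : Σ n : ℕ, T.CompleteType (Fin n) => r.2
  choose x hx using hN
  obtain ⟨S, _, hpS, hqS⟩ := exists_countable_elementarySubstructure_closed (L := L)
    (Set.countable_range (x p)) (fun a => Set.range (x (q ⟨a.1, T.typeOf a.2⟩)))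
    fun _ => Set.countable_range _
  have mem_of_range_subset {r} (hr : Set.range (x r) ⊆ S) : r ∈ tupleTypes T S := by
    simpa only [hx] using
      typeOf_mem_tupleTypes_of_forall_mem (T := T) S fun i => hr (Set.mem_range_self i)
  obtain ⟨K, ⟨e⟩⟩ := exists_countableModel_equiv (T := T) S
  refine ⟨K, ?_⟩
  rw [← tupleTypes_eq_of_equiv e]
  refine ⟨mem_of_range_subset hpS, ?_⟩
  rintro _ ⟨⟨n, a⟩, rfl⟩
  have hqa := hqS ⟨n, S.subtype ∘ a⟩ fun i => (a i).2
  rw [typeOf_comp_elementaryEmbedding] at hqa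
  exact mem_of_range_subset hqa

theorem exists_forall_notMem_tupleTypes_of_isPrimeOver
    [Uncountable (Σ n : ℕ, T.CompleteType (Fin n))] (p : Σ n : ℕ, T.CompleteType (Fin n)) :
    ∃ q : Σ n : ℕ, T.CompleteType (Fin n), ∀ (K : CountableModel.{u, v} T) (a : Fin p.1 → K.1),
      T.typeOf a = p.2 → IsPrimeOver L a → q ∉ tupleTypes T K.1 := by
  by_cases h : ∃ (K : CountableModel T) (a : Fin p.1 → K.1), T.typeOf a = p.2
  · obtain ⟨K₀, a₀, ha₀⟩ := h
    have := K₀.2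
    obtain ⟨q, hq⟩ : ∃ q, q ∉ tupleTypes T K₀.1 := by
      by_contra! h
      exact Set.not_countable_univ (countable_tupleTypes.mono fun q _ => h q)
    refine ⟨q, fun K a ha hprime hqK => hq ?_⟩
    obtain ⟨f, -⟩ := hprime K₀.1 a₀ (typeOf_eq_typeOf_iff.1 (ha.trans ha₀.symm))
    exact tupleTypes_subset_of_elementaryEmbedding f hqK
  · exact ⟨p, fun K a ha => (h ⟨K, a, ha⟩).elim⟩

theorem exists_countableModel_not_isPrimeOverTuple [Countable L.Symbols] (hT : T.IsComplete)
    [Uncountable (Σ n : ℕ, T.CompleteType (Fin n))] (p : Σ n : ℕ, T.CompleteType (Fin n)) :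
    ∃ K : CountableModel T, p ∈ tupleTypes T K.1 ∧ ¬ IsPrimeOverTuple T K.1 := by
  choose q hq using exists_forall_notMem_tupleTypes_of_isPrimeOver (T := T)
  obtain ⟨K, hp, hK⟩ := exists_countableModel_mapsTo_tupleTypes hT q p
  exact ⟨K, hp, fun ⟨_, n, a, ha⟩ =>
    hq ⟨n, T.typeOf a⟩ K a rfl ha (hK (typeOf_mem_tupleTypes a))⟩

theorem isPrimeOverTuple_of_equiv {M N : Type w} [L.Structure M] [L.Structure N] (f : M ≃[L] N)
    (h : IsPrimeOverTuple T M) : IsPrimeOverTuple T N := by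
  obtain ⟨hM, n, a, ha⟩ := h
  refine ⟨StrongHomClass.theory_model f, n, f ∘ a, fun K _ b hb => ?_⟩
  obtain ⟨g, hg⟩ := ha K b fun φ => (f.toElementaryEmbedding.map_formula φ a).symm.trans (hb φ)
  refine ⟨g.comp f.symm.toElementaryEmbedding, fun i => ?_⟩
  simpa using hg i

end CountableModel

section IsoType

variable {L : FirstOrder.Language.{u, v}} {T : L.Theory}

/-- The set of complete types realized in the models of a given isomorphism type. -/
def IsoType.tupleTypes (c : IsoType T) : Set (Σ n : ℕ, T.CompleteType (Fin n)) :=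
  Quotient.lift (s := isoSetoid T) (fun M => CountableModels.tupleTypes T M.1)
    (fun _ _ ⟨f⟩ => tupleTypes_eq_of_equiv f) c

theorem IsoType.countable_tupleTypes (c : IsoType T) : c.tupleTypes.Countable :=
  Quotient.inductionOn c fun M =>
    have := M.2
    CountableModels.countable_tupleTypes

theorem lift_mk_completeTypes_le {X : Set (IsoType T)} (hX : ∀ p, ∃ c ∈ X, p ∈ c.tupleTypes) :
    lift.{max u v 1} #(Σ n : ℕ, T.CompleteType (Fin n)) ≤ #X * ℵ₀ := by
  have hcover : ⋃ c : X, c.1.tupleTypes = Set.univ := by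
    refine Set.eq_univ_of_forall fun p => ?_
    obtain ⟨c, hc, hp⟩ := hX p
    exact Set.mem_iUnion.2 ⟨⟨c, hc⟩, hp⟩
  calc
    _ = lift.{max u v 1} #(⋃ c : X, c.1.tupleTypes) := by rw [hcover, mk_univ]
    _ ≤ lift.{max u v} #X * ⨆ c : X, lift.{max u v 1} #c.1.tupleTypes := mk_iUnion_le_lift _
    _ ≤ #X * ℵ₀ := by
      gcongr
      · exact (lift_id'.{max u v, 1} _).le
      · exact ciSup_le' fun c => lift_le_aleph0.2 c.1.countable_tupleTypes.le_aleph0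

theorem IsUnsmall.uncountable_completeTypes (hT : IsUnsmall T) :
    Uncountable (Σ n : ℕ, T.CompleteType (Fin n)) := by
  rw [← aleph0_lt_mk_iff, hT.continuum_types]
  exact aleph0_lt_continuum

theorem IsUnsmall.continuum_le_mk (hT : IsUnsmall T) {X : Set (IsoType T)}
    (hX : ∀ p, ∃ c ∈ X, p ∈ c.tupleTypes) : 𝔠 ≤ #X := by
  have h := lift_mk_completeTypes_le hX
  rw [hT.continuum_types, lift_continuum] at h
  by_contra! hlt
  exact h.not_gt (mul_lt_of_lt aleph0_le_continuum hlt aleph0_lt_continuum)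

theorem exists_mem_primeTypes_of_mem_limitTypes {c : IsoType T} (hc : c ∈ limitTypes T)
    {p : Σ n : ℕ, T.CompleteType (Fin n)} (hp : p ∈ c.tupleTypes) :
    ∃ d ∈ primeTypes T, p ∈ d.tupleTypes := by
  obtain ⟨M, rfl, hM⟩ := hc
  have := M.2
  obtain ⟨S, hS, hpS⟩ := hM.exists_isPrimeOverTuple hp
  have : Countable S := inferInstance
  exact ⟨_, ⟨⟨Theory.ModelType.of T S, this⟩, rfl, hS⟩, hpS⟩

theorem IsUnsmall.exists_notMem_primeTypes (hT : IsUnsmall T)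
    (p : Σ n : ℕ, T.CompleteType (Fin n)) : ∃ c ∉ primeTypes T, p ∈ c.tupleTypes := by
  have := hT.countable_language
  have := hT.uncountable_completeTypes
  obtain ⟨K, hp, hK⟩ := exists_countableModel_not_isPrimeOverTuple hT.complete p
  refine ⟨Quotient.mk _ K, ?_, hp⟩
  rintro ⟨M, hMK, hM⟩
  obtain ⟨f⟩ : Nonempty (M.1 ≃[L] K.1) := Quotient.exact hMK
  exact hK (isPrimeOverTuple_of_equiv f hM)

theorem IsUnsmall.continuum_le_mk_primeTypes_union_otherTypes (hT : IsUnsmall T) :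
    𝔠 ≤ #(primeTypes T ∪ otherTypes T : Set (IsoType T)) := by
  refine hT.continuum_le_mk fun p => ?_
  obtain ⟨c, hc, hp⟩ := hT.exists_notMem_primeTypes p
  by_cases hlim : c ∈ limitTypes T
  · obtain ⟨d, hd, hpd⟩ := exists_mem_primeTypes_of_mem_limitTypes hlim hp
    exact ⟨d, Or.inl hd, hpd⟩
  · exact ⟨c, Or.inr ⟨hc, hlim⟩, hp⟩

theorem IsUnsmall.continuum_le_mk_limitTypes_union_otherTypes (hT : IsUnsmall T) :
    𝔠 ≤ #(limitTypes T ∪ otherTypes T : Set (IsoType T)) := by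
  refine hT.continuum_le_mk fun p => ?_
  obtain ⟨c, hc, hp⟩ := hT.exists_notMem_primeTypes p
  exact ⟨c, or_iff_not_imp_left.2 fun hlim => ⟨hc, hlim⟩, hp⟩

end IsoType

end CountableModels

theorem proposition5p4 {L : FirstOrder.Language.{u, v}} (T : L.Theory)
    (hT : CountableModels.IsUnsmall T) :
    (¬ ∃ κ₁ κ₃ : Cardinal.{max u v 1}, κ₁ < 𝔠 ∧ κ₃ < 𝔠 ∧
      CountableModels.cm3 T = (κ₁, 𝔠, κ₃)) ∧
    (¬ ∃ κ₂ κ₃ : Cardinal.{max u v 1}, κ₂ < 𝔠 ∧ κ₃ < 𝔠 ∧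
      CountableModels.cm3 T = (𝔠, κ₂, κ₃)) := by
  constructor
  · rintro ⟨κ₁, κ₃, h₁, h₃, h⟩
    simp only [CountableModels.cm3, Prod.mk.injEq] at h
    obtain ⟨rfl, -, rfl⟩ := h
    exact (hT.continuum_le_mk_primeTypes_union_otherTypes).not_gt
      ((mk_union_le _ _).trans_lt (add_lt_of_lt aleph0_le_continuum h₁ h₃))
  · rintro ⟨κ₂, κ₃, h₂, h₃, h⟩
    simp only [CountableModels.cm3, Prod.mk.injEq] at h
    obtain ⟨-, rfl, rfl⟩ := h
    exact (hT.continuum_le_mk_limitTypes_union_otherTypes).not_gt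
      ((mk_union_le _ _).trans_lt (add_lt_of_lt aleph0_le_continuum h₂ h₃))
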